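/- **Theorem.** Let $B_1$ be the indicator function of $[0,1)$ and, for $d\ge 2$, let $B_d=B_1*B_{d-1}$, i.e. $B_d(t)=\int_{-\infty}^{\infty}B_1(t-y)B_{d-1}(y)\,dy$ (the cardinal B-spline of order $d$). Let $k\ge 0$ be an integer and put $$F_{k,d}(x)=\Big(\frac d{12}\Big)^{\frac{k+1}2}B_d^{(k)}\Big(\sqrt{\tfrac d{12}}\,x+\tfrac d2\Big),\qquad G_k(x)=\frac1{\sqrt{2\pi}}\,\frac{d^k}{dx^k}e^{-x^2/2}.$$ For every integer $d>k+2$ the function $B_d$ is $k$ times continuously differentiable on $\mathbb R$, and $$F_{k,d}(x)=G_k(x)+O\Big(\frac1d\Big)$$ uniformly in $x$: there is a constant $C$ depending only on $k$ such that $|F_{k,d}(x)-G_k(x)|\le C/d$ for all integers $d>k+2$ and all $x\in\mathbb R$. Moreover, $$\lim_{d\to\infty}F_{k,d}=G_k$$ both pointwise on $\mathbb R$ and in $L^p(\mathbb R)$ for every $p\in[2,\infty)$; that is, $G_k\in L^p(\mathbb R)$, $F_{k,d}\in L^p(\mathbb R)$ for every integer $d>k+2$, and $\|F_{k,d}-G_k\|_{L^p(\mathbb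 R)}\to 0$ as $d\to\infty$. -/

import Mathlib

open MeasureTheory Filter Topology
open scoped ENNReal

/-- The cardinal B-spline of order one, the indicator function of `[0, 1)`. -/
noncomputable def unitBox : ℝ → ℝ := Set.indicator (Set.Ico (0 : ℝ) 1) (fun _ => 1)

/-- The cardinal B-spline `B_d` of order `d`: `B_1` is the indicator function of `[0, 1)`, and
`B_d = B_1 * B_{d-1}` (convolution with respect to Lebesgue measure) for `d ≥ 2`.
The value at `d = 0` is a placeholder, since orders start at one. -/
noncomputable def bspline : ℕ → ℝ → ℝ
  | 0 => 0
  | 1 => unitBox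
  | d + 2 => convolution unitBox (bspline (d + 1)) (ContinuousLinearMap.mul ℝ ℝ) volume

/-- The rescaled derivative `x ↦ (d/12)^{(k+1)/2} B_d^{(k)}(√(d/12) x + d/2)`. -/
noncomputable def rescaledBsplineDeriv (k d : ℕ) (x : ℝ) : ℝ :=
  ((d : ℝ) / 12) ^ (((k : ℝ) + 1) / 2) *
    iteratedDeriv k (bspline d) (Real.sqrt ((d : ℝ) / 12) * x + (d : ℝ) / 2)

/-- The function `(1/√(2π)) D^k exp(-x²/2)`. -/
noncomputable def gaussianDeriv (k : ℕ) (x : ℝ) : ℝ :=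
  1 / Real.sqrt (2 * Real.pi) * iteratedDeriv k (fun t : ℝ => Real.exp (-t ^ 2 / 2)) x

open scoped FourierTransform Convolution

/-! This is a local central limit theorem proved on the Fourier side. Centered and scaled to
variance one, `B_d` has transform `sinc(v)^d` with `v = √(3/d) u`, `u = 2πξ`, while the Gaussian
density has transform `exp(-u²/2)`. The main estimate, `exists_abs_pow_mul_sinc_pow_sub_exp_le`,
bounds `|u|^k` times their difference by `C/d · (1+u²)⁻¹`. Fourier inversion turns k-th derivatives
into k-th moments, so integrating this bound gives the uniform `O(1/d)`, and with it pointwise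
convergence.

For `L^p`, the rescaled spline vanishes when `x² > 3d`. Where `x² ≤ 3d`, half of the rate `1/d` can
be traded for decay `(1+x²)^(-1/2)`; elsewhere only the Gaussian tail remains. Hence the error is at
most `C/√d` times a fixed `L^p` function. -/

/-! ### Elementary bounds for `sinc` -/

theorem abs_sinc_sub_one_sub_sq_le {v : ℝ} (hv : |v| ≤ 1) :
    |Real.sinc v - (1 - v ^ 2 / 6)| ≤ v ^ 4 / 100 := by
  rcases eq_or_ne v 0 with rfl | h0
  · simp
  have h := Real.sin_bound hv
  have e : Real.sin v - (v - v ^ 3 / 6) = v * (Real.sinc v - (1 - v ^ 2 / 6)) := by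
    rw [Real.sinc_of_ne_zero h0]; field_simp
  rw [e, abs_mul] at h
  have h1 : 0 < |v| := abs_pos.2 h0
  have e2 : |v| ^ 5 / 100 = |v| * (v ^ 4 / 100) := by
    rw [← (show Even 4 by decide).pow_abs v]; ring
  rw [e2] at h
  exact le_of_mul_le_mul_left h h1

theorem sinc_two_mul (w : ℝ) : Real.sinc (2 * w) = Real.sinc w * Real.cos w := by
  rcases eq_or_ne w 0 with rfl | h0
  · simp
  rw [Real.sinc_of_ne_zero h0, Real.sinc_of_ne_zero (by simpa using h0), Real.sin_two_mul]
  field_simp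

theorem sinc_nonneg_of_abs_le_two {v : ℝ} (hv : |v| ≤ 2) : 0 ≤ Real.sinc v := by
  rcases eq_or_ne v 0 with rfl | h0
  · simp
  wlog hp : 0 < v generalizing v
  · rw [← Real.sinc_neg]
    exact this (by simpa using hv) (by simpa using h0)
      (by have := lt_of_le_of_ne (not_lt.1 hp) h0; linarith)
  rw [Real.sinc_of_ne_zero h0]
  exact div_nonneg (Real.sin_nonneg_of_nonneg_of_le_pi hp.le
    (by have := Real.pi_gt_three; have := le_abs_self v; linarith)) hp.le

/-- Dropping the cosine in `sinc 2w = sinc w · cos w` halves the argument, bringing it into the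
range of the Taylor bound. -/
theorem sinc_le_exp_neg_sq {v : ℝ} (hv : |v| ≤ 2) : Real.sinc v ≤ Real.exp (-(v ^ 2 / 32)) := by
  obtain ⟨w, rfl⟩ : ∃ w, v = 2 * w := ⟨v / 2, by ring⟩
  have hw : |w| ≤ 1 := by rw [abs_mul, abs_two] at hv; linarith
  have h0 := sinc_nonneg_of_abs_le_two (hw.trans one_le_two)
  have hw2 : w ^ 2 ≤ 1 := by rw [← sq_abs]; nlinarith [abs_nonneg w]
  have h1 := (abs_le.1 (abs_sinc_sub_one_sub_sq_le hw)).2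
  rw [sinc_two_mul]
  calc Real.sinc w * Real.cos w ≤ Real.sinc w * 1 := by gcongr; exact Real.cos_le_one w
    _ ≤ -((2 * w) ^ 2 / 32) + 1 := by nlinarith [sq_nonneg w]
    _ ≤ _ := Real.add_one_le_exp _

/-- Both functions are `1 - v²/6 + O(v⁴)` near zero; for `|v| ≥ 1` boundedness by one suffices. -/
theorem abs_sinc_sub_exp_le {v : ℝ} :
    |Real.sinc v - Real.exp (-(v ^ 2 / 6))| ≤ 2 * v ^ 4 := by
  have hv4 : 0 ≤ v ^ 4 := by positivity
  rcases le_total |v| 1 with hv | hv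
  · have h1 := abs_le.1 (abs_sinc_sub_one_sub_sq_le hv)
    have h2 := Real.one_sub_le_exp_neg (v ^ 2 / 6)
    have hv2 : v ^ 2 ≤ 1 := by rw [← sq_abs]; nlinarith [abs_nonneg v]
    have h3 := abs_le.1 (Real.abs_exp_sub_one_sub_id_le (x := -(v ^ 2 / 6))
      (by rw [abs_neg, abs_of_nonneg (by positivity)]; linarith))
    rw [abs_le]
    constructor <;> nlinarith
  · have h1 := abs_le.1 (Real.abs_sinc_le_one v)
    have h2 : Real.exp (-(v ^ 2 / 6)) ≤ 1 := Real.exp_le_one_iff.2 (by linarith [sq_nonneg v])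
    have h3 := Real.exp_pos (-(v ^ 2 / 6))
    have : 1 ≤ v ^ 4 := by
      rw [← (show Even 4 by decide).pow_abs v]; exact one_le_pow₀ hv
    rw [abs_le]
    constructor <;> linarith

theorem abs_sinc_le_inv_abs {v : ℝ} (hv : v ≠ 0) : |Real.sinc v| ≤ |v|⁻¹ := by
  rw [Real.sinc_of_ne_zero hv, abs_div, div_eq_mul_inv]
  exact mul_le_of_le_one_left (by positivity) (Real.abs_sin_le_one v)

/-! ### Powers against exponentials -/

theorem abs_le_one_add_sq (u : ℝ) : |u| ≤ 1 + u ^ 2 := by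
  rw [← sq_abs]; nlinarith [sq_nonneg (|u| - 1)]

/-- A Gaussian beats every power of `1 + u ^ 2`. -/
theorem exists_one_add_sq_pow_mul_exp_le (m : ℕ) {c : ℝ} (hc : 0 < c) :
    ∃ C, 0 ≤ C ∧ ∀ u : ℝ, (1 + u ^ 2) ^ m * Real.exp (-(c * u ^ 2)) ≤ C := by
  refine ⟨m.factorial * Real.exp c / c ^ m, by positivity, fun u => ?_⟩
  have h := Real.pow_div_factorial_le_exp (c * (1 + u ^ 2)) (by positivity) m
  rw [div_le_iff₀ (by positivity), mul_pow, mul_add, Real.exp_add, mul_one] at h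
  rw [le_div_iff₀ (by positivity), Real.exp_neg]
  have := Real.exp_pos (c * u ^ 2)
  rw [← div_eq_mul_inv, div_mul_eq_mul_div, div_le_iff₀ this]
  linarith

theorem exists_pow_le_two_pow (m : ℕ) :
    ∃ C, 0 ≤ C ∧ ∀ d : ℕ, (d : ℝ) ^ m / 2 ^ d ≤ C := by
  obtain ⟨C, hC⟩ := (tendsto_pow_const_div_const_pow_of_one_lt m (one_lt_two (α := ℝ))).bddAbove_range
  have h (d : ℕ) : (d : ℝ) ^ m / 2 ^ d ≤ C := hC ⟨d, rfl⟩
  exact ⟨C, le_trans (by positivity) (h 0), h⟩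

/-! ### Comparison of `sinc^d` with the Gaussian -/

section
variable {d : ℕ} {u v : ℝ}

/-- Factoring `a^d - b^d` costs a factor `d`, but `a - b = O(v⁴) = O(u⁴/d²)`; the remaining `d - 1`
factors supply Gaussian decay. -/
theorem abs_sinc_pow_sub_exp_le_near (hd : 3 ≤ d) (hv : |v| ≤ 2) (huv : d * v ^ 2 = 3 * u ^ 2) :
    |Real.sinc v ^ d - Real.exp (-u ^ 2 / 2)| ≤
      18 * u ^ 4 / d * Real.exp (-(1 / 16 * u ^ 2)) := by
  have hd' : (3 : ℝ) ≤ d := by exact_mod_cast hd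
  have hd0 : (0 : ℝ) < d := by linarith
  have e1 : Real.exp (-u ^ 2 / 2) = Real.exp (-(v ^ 2 / 6)) ^ d := by
    rw [← Real.exp_nat_mul]; congr 1; linear_combination huv / 6
  have h0 := sinc_nonneg_of_abs_le_two hv
  have hm : max |Real.sinc v| |Real.exp (-(v ^ 2 / 6))| ≤ Real.exp (-(v ^ 2 / 32)) := by
    rw [abs_of_nonneg h0, abs_of_nonneg (Real.exp_pos _).le]
    exact max_le (sinc_le_exp_neg_sq hv) (Real.exp_le_exp.2 (by linarith [sq_nonneg v]))
  -- Since `d ≥ 3`, `(d-1)v² ≥ (2/3)dv² = 2u²`.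
  have e2 : Real.exp (-(v ^ 2 / 32)) ^ (d - 1) ≤ Real.exp (-(1 / 16 * u ^ 2)) := by
    rw [← Real.exp_nat_mul]
    apply Real.exp_le_exp.2
    rw [Nat.cast_sub (by omega), Nat.cast_one]
    nlinarith [sq_nonneg v]
  rw [e1]
  calc _ ≤ |Real.sinc v - Real.exp (-(v ^ 2 / 6))| * d *
        max |Real.sinc v| |Real.exp (-(v ^ 2 / 6))| ^ (d - 1) := abs_pow_sub_pow_le ..
    _ ≤ (2 * v ^ 4) * d * Real.exp (-(1 / 16 * u ^ 2)) := by
        gcongr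
        · exact abs_sinc_sub_exp_le
        · exact (pow_le_pow_left₀ (by positivity) hm _).trans e2
    _ = _ := by
        congr 1
        have : v ^ 2 = 3 * u ^ 2 / d := by rw [eq_div_iff hd0.ne']; linarith
        rw [show v ^ 4 = (v ^ 2) ^ 2 by ring, this]
        field_simp; ring

/-- Using `|sinc v| ≤ 1/|v|` and `|u| ≤ d|v|`, `k+2` of the `d` factors absorb `|u|^(k+2)`, and the
rest decay like `2^(-(d-k-2))`. The two extra powers of `u` pay for `(1+u²)⁻¹`, the extra power of
`d` in `hC` for `1/d`. -/
theorem abs_pow_mul_sinc_pow_le_far (k : ℕ) {C : ℝ}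
    (hC : ∀ d : ℕ, (d : ℝ) ^ (k + 3) / 2 ^ d ≤ C) (hd : k + 2 < d) (hv : 2 ≤ |v|)
    (huv : d * v ^ 2 = 3 * u ^ 2) :
    |u| ^ k * |Real.sinc v| ^ d ≤ 2 ^ (k + 3) * C / d * (1 + u ^ 2)⁻¹ := by
  have hd' : (2 : ℝ) ≤ d := by exact_mod_cast (by omega : 2 ≤ d)
  have hd0 : (0 : ℝ) < d := by linarith
  have hv0 : 0 < |v| := by linarith
  have hv2 : 4 ≤ v ^ 2 := by rw [← sq_abs]; nlinarith
  have hu : 1 ≤ u ^ 2 := by nlinarith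
  have hu' : |u| ≤ d * |v| := by
    rw [← abs_of_pos hd0, ← abs_mul]
    apply sq_le_sq.1
    nlinarith [sq_nonneg v]
  have hs : |Real.sinc v| ≤ |v|⁻¹ := abs_sinc_le_inv_abs (abs_pos.1 hv0)
  have key : |u| ^ (k + 2) * |Real.sinc v| ^ d ≤ 2 ^ (k + 2) * C / d := by
    obtain ⟨n, rfl⟩ := Nat.exists_eq_add_of_lt hd
    set d := k + 2 + n + 1
    calc |u| ^ (k + 2) * |Real.sinc v| ^ d ≤ (d * |v|) ^ (k + 2) * |v|⁻¹ ^ d := by gcongr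
      _ = (d : ℝ) ^ (k + 2) * |v|⁻¹ ^ (n + 1) := by
        rw [show d = (k + 2) + (n + 1) from rfl, pow_add |v|⁻¹, mul_pow, inv_pow, inv_pow]
        field_simp
      _ ≤ (d : ℝ) ^ (k + 2) * 2⁻¹ ^ (n + 1) := by gcongr
      _ = 2 ^ (k + 2) * ((d : ℝ) ^ (k + 3) / 2 ^ d) / d := by
        rw [show (2 : ℝ) ^ d = 2 ^ (k + 2) * 2 ^ (n + 1) from pow_add 2 (k + 2) (n + 1), inv_pow, pow_succ _ (k + 2)]
        field_simp
      _ ≤ _ := by gcongr; exact hC d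
  rw [← div_eq_mul_inv, le_div_iff₀ (by positivity)]
  calc |u| ^ k * |Real.sinc v| ^ d * (1 + u ^ 2)
      ≤ |u| ^ k * |Real.sinc v| ^ d * (2 * u ^ 2) := by gcongr; linarith
    _ = 2 * (|u| ^ (k + 2) * |Real.sinc v| ^ d) := by rw [← sq_abs u]; ring
    _ ≤ 2 * (2 ^ (k + 2) * C / d) := by gcongr
    _ = _ := by ring

/-- In this range `u² ≥ d`, so inserting `u²/d` only increases the left side. -/
theorem abs_pow_mul_exp_le_far (k : ℕ) (hd : 0 < d) (hv : 2 ≤ |v|)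
    (huv : d * v ^ 2 = 3 * u ^ 2) :
    |u| ^ k * Real.exp (-u ^ 2 / 2) ≤
      (|u| ^ k * u ^ 2 * Real.exp (-u ^ 2 / 2)) / d := by
  have hd0 : (0 : ℝ) < d := by exact_mod_cast hd
  have hv2 : 4 ≤ v ^ 2 := by rw [← sq_abs]; nlinarith
  have hu : d ≤ u ^ 2 := by nlinarith
  rw [le_div_iff₀ hd0, mul_right_comm]
  gcongr
end

/-- The characteristic function of a normalized sum of `d` uniform variables is `O(1/d)`-close
to the Gaussian, with integrable weights. -/
theorem exists_abs_pow_mul_sinc_pow_sub_exp_le (k : ℕ) :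
    ∃ C, 0 ≤ C ∧ ∀ d : ℕ, k + 2 < d → ∀ u : ℝ,
      |u| ^ k * |Real.sinc (Real.sqrt (3 / d) * u) ^ d - Real.exp (-u ^ 2 / 2)| ≤
        C / d * (1 + u ^ 2)⁻¹ := by
  obtain ⟨C₁, hC₁, h₁⟩ := exists_one_add_sq_pow_mul_exp_le (k + 3) (c := 1 / 16) (by norm_num)
  obtain ⟨C₂, hC₂, h₂⟩ := exists_pow_le_two_pow (k + 3)
  refine ⟨18 * C₁ + (2 ^ (k + 3) * C₂ + C₁), by positivity, fun d hd u => ?_⟩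
  have hd0 : (0 : ℝ) < d := by exact_mod_cast (by omega : 0 < d)
  have hu1 : |u| ≤ 1 + u ^ 2 := abs_le_one_add_sq u
  have hu2 : u ^ 2 ≤ 1 + u ^ 2 := by linarith
  have hu0 : 1 ≤ 1 + u ^ 2 := by linarith [sq_nonneg u]
  set v := Real.sqrt (3 / d) * u with hv
  have huv : d * v ^ 2 = 3 * u ^ 2 := by
    rw [hv, mul_pow, Real.sq_sqrt (by positivity)]; field_simp
  -- Up to 2, `sinc` is nonnegative with a Gaussian majorant; beyond, `1/|v| ≤ 1/2` gives geometric
  -- decay in `d`.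
  rcases le_total |v| 2 with h | h
  · calc _ ≤ |u| ^ k * (18 * u ^ 4 / d * Real.exp (-(1 / 16 * u ^ 2))) := by
          gcongr
          exact abs_sinc_pow_sub_exp_le_near (by omega) h huv
      _ = 18 / d * (|u| ^ k * (u ^ 2) ^ 2 * (1 + u ^ 2) * Real.exp (-(1 / 16 * u ^ 2))) *
          (1 + u ^ 2)⁻¹ := by field_simp
      _ ≤ 18 / d * ((1 + u ^ 2) ^ k * (1 + u ^ 2) ^ 2 * (1 + u ^ 2) *
          Real.exp (-(1 / 16 * u ^ 2))) * (1 + u ^ 2)⁻¹ := by gcongr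
      _ = 18 / d * ((1 + u ^ 2) ^ (k + 3) * Real.exp (-(1 / 16 * u ^ 2))) * (1 + u ^ 2)⁻¹ := by
          ring
      _ ≤ 18 / d * C₁ * (1 + u ^ 2)⁻¹ := by gcongr; exact h₁ u
      _ = 18 * C₁ / d * (1 + u ^ 2)⁻¹ := by ring
      _ ≤ _ := by
          gcongr ?_ / _ * _
          linarith [show 0 ≤ 2 ^ (k + 3) * C₂ by positivity]
  · have e : |u| ^ k * u ^ 2 * Real.exp (-u ^ 2 / 2) ≤ C₁ * (1 + u ^ 2)⁻¹ := by
      rw [← div_eq_mul_inv, le_div_iff₀ (by positivity)]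
      calc _ ≤ (1 + u ^ 2) ^ k * (1 + u ^ 2) * Real.exp (-(1 / 16 * u ^ 2)) * (1 + u ^ 2) := by
            gcongr
            linarith [sq_nonneg u]
        _ ≤ (1 + u ^ 2) ^ k * (1 + u ^ 2) * Real.exp (-(1 / 16 * u ^ 2)) * (1 + u ^ 2) ^ 2 := by
            gcongr
            exact le_self_pow₀ hu0 two_ne_zero
        _ = (1 + u ^ 2) ^ (k + 3) * Real.exp (-(1 / 16 * u ^ 2)) := by ring
        _ ≤ C₁ := h₁ u
    calc _ ≤ |u| ^ k * (|Real.sinc v| ^ d + Real.exp (-u ^ 2 / 2)) := by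
          gcongr
          refine (abs_sub _ _).trans ?_
          rw [abs_pow, abs_of_pos (Real.exp_pos _)]
      _ = |u| ^ k * |Real.sinc v| ^ d + |u| ^ k * Real.exp (-u ^ 2 / 2) := mul_add ..
      _ ≤ 2 ^ (k + 3) * C₂ / d * (1 + u ^ 2)⁻¹ + (C₁ * (1 + u ^ 2)⁻¹) / d := by
          gcongr ?_ + ?_
          · exact abs_pow_mul_sinc_pow_le_far k h₂ hd h huv
          · exact (abs_pow_mul_exp_le_far k (by omega) h huv).trans (by gcongr)
      _ = (2 ^ (k + 3) * C₂ + C₁) / d * (1 + u ^ 2)⁻¹ := by ring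
      _ ≤ _ := by
          gcongr ?_ / _ * _
          linarith

/-! ### Integrability, continuity and support of B-splines -/

theorem integrable_unitBox : Integrable unitBox :=
  (integrable_indicator_iff measurableSet_Ico).2 (by simp [integrableOn_const_iff])

theorem integrable_bspline : ∀ d, Integrable (bspline d)
  | 0 => integrable_zero ..
  | 1 => integrable_unitBox
  | d + 2 => integrable_unitBox.integrable_convolution _ (integrable_bspline (d + 1))

theorem bspline_add_two (d : ℕ) (x : ℝ) :
    bspline (d + 2) x = ∫ y in (x - 1)..x, bspline (d + 1) y := by
  have h : bspline (d + 2) x = ∫ t in (0 : ℝ)..1, bspline (d + 1) (x - t) := by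
    rw [intervalIntegral.integral_of_le zero_le_one, integral_Ioc_eq_integral_Ioo,
      ← integral_Ico_eq_integral_Ioo, ← integral_indicator measurableSet_Ico]
    simp only [bspline, convolution, ContinuousLinearMap.mul_apply']
    congr 1 with t
    by_cases ht : t ∈ Set.Ico (0 : ℝ) 1
    · simp [unitBox, Set.indicator_of_mem ht]
    · simp [unitBox, Set.indicator_of_notMem ht]
  rw [h, intervalIntegral.integral_comp_sub_left, sub_zero]

theorem continuous_bspline (d : ℕ) : Continuous (bspline (d + 2)) := by
  have h : Continuous fun x => ∫ y in (0 : ℝ)..x, bspline (d + 1) y :=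
    intervalIntegral.continuous_primitive (fun _ _ => (integrable_bspline _).intervalIntegrable) 0
  have e : bspline (d + 2) = fun x => (∫ y in (0 : ℝ)..x, bspline (d + 1) y) -
      ∫ y in (0 : ℝ)..(x - 1), bspline (d + 1) y := by
    ext x
    rw [bspline_add_two, intervalIntegral.integral_interval_sub_left] <;>
    exact (integrable_bspline _).intervalIntegrable
  rw [e]
  exact h.sub (h.comp (by fun_prop))

theorem support_bspline_subset : ∀ d : ℕ, Function.support (bspline d) ⊆ Set.Icc 0 (d : ℝ)
  | 0 => by simp [bspline]
  | 1 => by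
    refine Set.support_indicator_subset.trans ?_
    simpa using Set.Ico_subset_Icc_self
  | d + 2 => by
    refine (support_convolution_subset _).trans ?_
    refine (Set.add_subset_add (support_bspline_subset 1) (support_bspline_subset (d + 1))).trans ?_
    refine (Set.Icc_add_Icc_subset ..).trans ?_
    apply Set.Icc_subset_Icc <;> push_cast <;> linarith

/-! ### Fourier transforms of B-splines -/

theorem fourier_unitBox (ξ : ℝ) :
    𝓕 (fun t => (unitBox t : ℂ)) ξ =
      Complex.exp (-(Real.pi * ξ * Complex.I)) * Real.sinc (Real.pi * ξ) := by
  have e : 𝓕 (fun t => (unitBox t : ℂ)) ξ =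
      ∫ t in (0 : ℝ)..1, Complex.exp ((-(2 * Real.pi * ξ * Complex.I)) * t) := by
    rw [Real.fourier_real_eq_integral_exp_smul, intervalIntegral.integral_of_le zero_le_one,
      integral_Ioc_eq_integral_Ioo, ← integral_Ico_eq_integral_Ioo,
      ← integral_indicator measurableSet_Ico]
    congr 1 with t
    by_cases ht : t ∈ Set.Ico (0 : ℝ) 1 
    · simp only [unitBox, Set.indicator_of_mem ht]
      push_cast
      rw [smul_eq_mul, mul_one]; congr 1; ring
    · simp [unitBox, Set.indicator_of_notMem ht]
  rw [e]
  rcases eq_or_ne ξ 0 with rfl | h0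
  · simp
  have hp : (Real.pi : ℂ) ≠ 0 := by exact_mod_cast Real.pi_ne_zero
  have hξ : (ξ : ℂ) ≠ 0 := by exact_mod_cast h0
  rw [integral_exp_mul_complex (by simp [hp, hξ, Complex.I_ne_zero]),
    Real.sinc_of_ne_zero (mul_ne_zero Real.pi_ne_zero h0)]
  push_cast
  rw [Complex.sin]
  have e2 : Complex.exp (-(2 * Real.pi * ξ * Complex.I)) =
    Complex.exp (-(Real.pi * ξ * Complex.I)) * Complex.exp (-(Real.pi * ξ * Complex.I)) := by
    rw [← Complex.exp_add]; congr 1; ring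
  have e3 : Complex.exp (-(Real.pi * ξ * Complex.I)) * Complex.exp (Real.pi * ξ * Complex.I) = 1 := by
    rw [← Complex.exp_add]; simp
  simp only [mul_one, mul_zero, Complex.exp_zero, neg_mul]
  rw [e2]
  field_simp
  rw [Complex.I_sq]
  linear_combination -e3

theorem fourier_bspline (d : ℕ) (ξ : ℝ) :
    𝓕 (fun t => (bspline (d + 1) t : ℂ)) ξ =
      (Complex.exp (-(Real.pi * ξ * Complex.I)) * Real.sinc (Real.pi * ξ)) ^ (d + 1) := by
  induction d with
  | zero => simpa [bspline] using fourier_unitBox ξ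
  | succ d ih =>
    have e : (fun t => (bspline (d + 2) t : ℂ)) =
        (fun t => (unitBox t : ℂ)) ⋆[ContinuousLinearMap.mul ℂ ℂ, volume]
          (fun t => (bspline (d + 1) t : ℂ)) := by
      ext t
      simp only [bspline, convolution, ContinuousLinearMap.mul_apply', ← Complex.ofReal_mul]
      exact integral_ofReal.symm
    have h₁ : Integrable fun t => (unitBox t : ℂ) := integrable_unitBox.ofReal
    have h₂ : Integrable fun t => (bspline (d + 1) t : ℂ) := (integrable_bspline _).ofReal
    rw [e, Real.fourier_mul_convolution_eq h₁ h₂, ih, fourier_unitBox, ← pow_succ']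

theorem fourier_comp_mul_add (f : ℝ → ℂ) {s : ℝ} (hs : 0 < s) (c ξ : ℝ) :
    𝓕 (fun x => (s : ℂ) * f (s * x + c)) ξ =
      Complex.exp (2 * Real.pi * (c * ξ / s) * Complex.I) * 𝓕 f (ξ / s) := by
  have hs' : (s : ℂ) ≠ 0 := by exact_mod_cast hs.ne'
  rw [Real.fourier_real_eq_integral_exp_smul, Real.fourier_real_eq_integral_exp_smul,
    ← integral_const_mul]
  set G : ℝ → ℂ := fun x => Complex.exp (2 * Real.pi * (c * ξ / s) * Complex.I) *
    (Complex.exp ((-2 * Real.pi * x * (ξ / s) : ℝ) * Complex.I) • f x) with hG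
  have h := Measure.integral_comp_mul_left (fun x => G (x + c)) s
  rw [integral_add_right_eq_self G c, abs_of_pos (inv_pos.2 hs), Complex.real_smul,
    Complex.ofReal_inv, eq_inv_mul_iff_mul_eq₀ hs', ← integral_const_mul] at h
  rw [← h]
  congr 1 with x
  simp only [hG, smul_eq_mul]
  rw [mul_left_comm, ← mul_assoc (Complex.exp (2 * Real.pi * (c * ξ / s) * Complex.I)),
    ← Complex.exp_add]
  congr 3
  push_cast
  field_simp
  ring

/-- The B-spline, centered and scaled to variance one. -/
noncomputable def scaledBspline (d : ℕ) (x : ℝ) : ℝ :=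
  Real.sqrt (d / 12) * bspline d (Real.sqrt (d / 12) * x + d / 2)

theorem fourier_scaledBspline {d : ℕ} (hd : 0 < d) (ξ : ℝ) :
    𝓕 (fun x => (scaledBspline d x : ℂ)) ξ =
      ((Real.sinc (Real.sqrt (3 / d) * (2 * Real.pi * ξ)) ^ d : ℝ) : ℂ) := by
  have hd0 : (0 : ℝ) < d := by exact_mod_cast hd
  have hs : 0 < Real.sqrt (d / 12) := Real.sqrt_pos.2 (by positivity)
  have e : Real.sqrt (3 / d) * (2 * Real.pi * ξ) = Real.pi * (ξ / Real.sqrt (d / 12)) := by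
    have : Real.sqrt (3 / d) * Real.sqrt (d / 12) = 1 / 2 := by
      rw [← Real.sqrt_mul (by positivity), Real.sqrt_eq_iff_mul_self_eq (by positivity) (by norm_num)]
      field_simp; norm_num
    field_simp
    linear_combination 2 * ξ * this
  obtain ⟨n, rfl⟩ : ∃ n, d = n + 1 := ⟨d - 1, by omega⟩
  have h := fourier_comp_mul_add (fun t => (bspline (n + 1) t : ℂ)) hs ((n + 1 : ℕ) / 2) ξ
  rw [fourier_bspline, mul_pow, ← mul_assoc, ← Complex.exp_nat_mul, ← Complex.exp_add] at h
  simp only [scaledBspline, Complex.ofReal_mul]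
  rw [h, e, Complex.ofReal_pow]
  -- The phase from the shift by `d/2` cancels the `d` phases of the boxes.
  convert one_mul _
  rw [Complex.exp_eq_one_iff]
  refine ⟨0, ?_⟩
  push_cast
  ring

theorem integrable_scaledBspline (d : ℕ) : Integrable (scaledBspline d) := by
  unfold scaledBspline
  rcases eq_or_ne d 0 with rfl | hd
  · simp
  have hs : Real.sqrt (d / 12) ≠ 0 := Real.sqrt_ne_zero'.2 (by positivity)
  exact (((integrable_bspline d).comp_add_right (d / 2 : ℝ)).comp_mul_left' hs).const_mul _

theorem continuous_scaledBspline {d : ℕ} (hd : 2 ≤ d) : Continuous (scaledBspline d) := by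
  obtain ⟨n, rfl⟩ := Nat.exists_eq_add_of_le' hd
  exact continuous_const.mul ((continuous_bspline n).comp (by fun_prop))

/-- Fourier inversion; evenness of `sinc` lets the forward transform replace the inverse. -/
theorem scaledBspline_eq_fourier {d : ℕ} (hd : 2 ≤ d)
    (hi : Integrable fun u : ℝ => Real.sinc (Real.sqrt (3 / d) * u) ^ d) :
    (fun x => (scaledBspline d x : ℂ)) =
      𝓕 fun ξ : ℝ => ((Real.sinc (Real.sqrt (3 / d) * (2 * Real.pi * ξ)) ^ d : ℝ) : ℂ) := by
  have hF := funext (fourier_scaledBspline (d := d) (by omega))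
  have hf : Integrable fun x => (scaledBspline d x : ℂ) := (integrable_scaledBspline d).ofReal
  have hc : Continuous fun x => (scaledBspline d x : ℂ) :=
    Complex.continuous_ofReal.comp (continuous_scaledBspline hd)
  have hi' : Integrable fun ξ : ℝ =>
      ((Real.sinc (Real.sqrt (3 / d) * (2 * Real.pi * ξ)) ^ d : ℝ) : ℂ) :=
    (hi.comp_mul_left' (R := 2 * Real.pi) (by positivity)).ofReal
  rw [← hc.fourierInv_fourier_eq hf (by rwa [hF]), hF, Real.fourierInv_eq_fourier_comp_neg]
  simp [Real.sinc_neg]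

theorem contDiff_bspline {k : ℕ∞} {d : ℕ} (hd : 0 < d) (h : ContDiff ℝ k (scaledBspline d)) :
    ContDiff ℝ k (bspline d) := by
  have hs : Real.sqrt (d / 12) ≠ 0 := Real.sqrt_ne_zero'.2 (by positivity)
  have e : bspline d = fun y => (Real.sqrt (d / 12))⁻¹ *
      scaledBspline d ((Real.sqrt (d / 12))⁻¹ * (y - d / 2)) := by
    ext y
    simp only [scaledBspline, mul_inv_cancel_left₀ hs, inv_mul_cancel_left₀ hs, sub_add_cancel]
  rw [e]
  exact contDiff_const.mul (h.comp (by fun_prop))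

theorem rescaledBsplineDeriv_eq_iteratedDeriv {k d : ℕ} (h : ContDiff ℝ (k : ℕ∞) (bspline d)) :
    rescaledBsplineDeriv k d = iteratedDeriv k (scaledBspline d) := by
  set s := Real.sqrt (d / 12) with hs
  have h' : ContDiff ℝ k fun y => bspline d (y + d / 2) := by
    exact ContDiff.comp (mod_cast h) (by fun_prop)
  ext x
  have e : scaledBspline d = fun x => s * (fun x => bspline d (s * x + d / 2)) x := rfl
  rw [e, iteratedDeriv_const_mul_field, iteratedDeriv_comp_const_mul h' s,
    iteratedDeriv_comp_add_const, rescaledBsplineDeriv, ← mul_assoc, ← pow_succ', ← hs]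
  congr 1
  rw [hs, Real.sqrt_eq_rpow, ← Real.rpow_natCast, ← Real.rpow_mul (by positivity)]
  congr 1
  push_cast; ring

/-! ### The Gaussian density and its transform -/

/-- The standard Gaussian density. -/
noncomputable def gaussianDensity (x : ℝ) : ℝ := 1 / Real.sqrt (2 * Real.pi) * Real.exp (-x ^ 2 / 2)

theorem contDiff_gaussianDensity {n : WithTop ℕ∞} : ContDiff ℝ n gaussianDensity := by
  unfold gaussianDensity; fun_prop

theorem gaussianDeriv_eq_iteratedDeriv (k : ℕ) :
    gaussianDeriv k = iteratedDeriv k gaussianDensity := by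
  ext x
  exact (iteratedDeriv_const_mul_field (1 / Real.sqrt (2 * Real.pi)) _).symm

theorem gaussianDensity_eq_fourier :
    (fun x => (gaussianDensity x : ℂ)) =
      𝓕 fun ξ : ℝ => ((Real.exp (-(2 * Real.pi * ξ) ^ 2 / 2) : ℝ) : ℂ) := by
  have h := fourier_gaussian_pi (b := ((2 * Real.pi : ℝ) : ℂ)) (by simpa using Real.pi_pos)
  have hp : (Real.pi : ℂ) ≠ 0 := by exact_mod_cast Real.pi_ne_zero
  have e : (fun ξ : ℝ => ((Real.exp (-(2 * Real.pi * ξ) ^ 2 / 2) : ℝ) : ℂ)) =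
      fun x : ℝ => Complex.exp (-Real.pi * ((2 * Real.pi : ℝ) : ℂ) * x ^ 2) := by
    ext x
    push_cast
    congr 1; ring
  rw [e, h]
  ext x
  rw [gaussianDensity, Real.sqrt_eq_rpow]
  push_cast [Complex.ofReal_cpow (show (0 : ℝ) ≤ 2 * Real.pi by positivity)]
  congr 2
  field_simp

/-! ### Moments of the transform and derivatives -/

theorem iteratedDeriv_ofReal {f : ℝ → ℝ} {k : ℕ} (hf : ContDiff ℝ k f) :
    iteratedDeriv k (fun x => (f x : ℂ)) = fun x => ((iteratedDeriv k f x : ℝ) : ℂ) := by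
  ext x
  have := Complex.ofRealCLM.iteratedFDeriv_comp_left (x := x) hf.contDiffAt (i := k) le_rfl
  rw [iteratedDeriv_eq_iteratedFDeriv, iteratedDeriv_eq_iteratedFDeriv]
  exact congrArg (fun L => L fun _ => 1) this

theorem contDiff_of_contDiff_ofReal {f : ℝ → ℝ} {n : WithTop ℕ∞}
    (hf : ContDiff ℝ n fun x => (f x : ℂ)) : ContDiff ℝ n f :=
  Complex.reCLM.contDiff.comp hf

theorem integrable_pow_mul_sinc_pow_sub_exp {n d : ℕ} (hd : n + 2 < d) :
    Integrable fun u : ℝ =>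
      u ^ n * (Real.sinc (Real.sqrt (3 / d) * u) ^ d - Real.exp (-u ^ 2 / 2)) := by
  obtain ⟨C, -, hC⟩ := exists_abs_pow_mul_sinc_pow_sub_exp_le n
  refine (integrable_inv_one_add_sq.const_mul (C / d)).mono' ?_ (.of_forall fun u => ?_)
  · have := Real.continuous_sinc
    exact Continuous.aestronglyMeasurable (by fun_prop)
  · rw [Real.norm_eq_abs, abs_mul, abs_pow]
    exact hC d hd u

theorem integrable_pow_mul_exp_neg_sq_div_two (n : ℕ) :
    Integrable fun u : ℝ => u ^ n * Real.exp (-u ^ 2 / 2) := by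
  have := integrable_rpow_mul_exp_neg_mul_sq (b := 1 / 2) (by norm_num) (s := n)
    (by linarith [Nat.cast_nonneg (α := ℝ) n])
  simp only [Real.rpow_natCast] at this
  convert this using 4
  ring

/-- Adding the Gaussian back to the difference avoids a separate tail estimate. -/
theorem integrable_pow_mul_sinc_pow {n d : ℕ} (hd : n + 2 < d) :
    Integrable fun u : ℝ => u ^ n * Real.sinc (Real.sqrt (3 / d) * u) ^ d := by
  refine ((integrable_pow_mul_sinc_pow_sub_exp hd).add
    (integrable_pow_mul_exp_neg_sq_div_two n)).congr (.of_forall fun u => ?_)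
  simp only [Pi.add_apply]
  ring

/-- Moments of a rescaled real function, viewed as a complex function. -/
theorem integrable_pow_smul_ofReal_comp {n : ℕ} {g : ℝ → ℝ}
    (hg : Integrable fun u : ℝ => u ^ n * g u) :
    Integrable fun ξ : ℝ => ξ ^ n • ((g (2 * Real.pi * ξ) : ℝ) : ℂ) := by
  have h : Integrable fun ξ : ℝ => (((2 * Real.pi * ξ) ^ n * g (2 * Real.pi * ξ) : ℝ) : ℂ) :=
    (hg.comp_mul_left' (R := 2 * Real.pi) (by positivity)).ofReal
  refine (h.const_mul ((((2 * Real.pi) ^ n)⁻¹ : ℝ) : ℂ)).congr (.of_forall fun ξ => ?_)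
  have h0 : (2 * Real.pi) ^ n ≠ 0 := by positivity
  dsimp only
  rw [Complex.real_smul, ← Complex.ofReal_mul, ← Complex.ofReal_mul, mul_pow (2 * Real.pi),
    mul_assoc, inv_mul_cancel_left₀ h0]

theorem contDiff_of_ofReal_eq_fourier {k : ℕ} {f g : ℝ → ℝ}
    (hf : (fun x => (f x : ℂ)) = 𝓕 fun ξ : ℝ => ((g (2 * Real.pi * ξ) : ℝ) : ℂ))
    (hg : ∀ n ≤ k, Integrable fun u : ℝ => u ^ n * g u) : ContDiff ℝ (k : ℕ∞) f := by
  refine contDiff_of_contDiff_ofReal ?_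
  rw [hf]
  refine Real.contDiff_fourier fun n hn => ?_
  simpa only [norm_smul, norm_pow] using
    (integrable_pow_smul_ofReal_comp (hg n (mod_cast hn))).norm

/-- Differentiation brings out `(2π|ξ|)^k = |u|^k` in absolute value; the substitution `u = 2πξ`
leaves only `(2π)⁻¹`. -/
theorem abs_iteratedDeriv_le_of_ofReal_eq_fourier {k : ℕ} {f g : ℝ → ℝ}
    (hf : (fun x => (f x : ℂ)) = 𝓕 fun ξ : ℝ => ((g (2 * Real.pi * ξ) : ℝ) : ℂ))
    (hg : ∀ n ≤ k, Integrable fun u : ℝ => u ^ n * g u) (x : ℝ) :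
    |iteratedDeriv k f x| ≤ (2 * Real.pi)⁻¹ * ∫ u : ℝ, |u| ^ k * |g u| := by
  have h := congrFun (iteratedDeriv_ofReal (mod_cast contDiff_of_ofReal_eq_fourier hf hg)) x
  rw [← Real.norm_eq_abs, ← Complex.norm_real, ← h, hf, Real.iteratedDeriv_fourier (N := k)
    (fun n hn => integrable_pow_smul_ofReal_comp (hg n (mod_cast hn))) le_rfl,
    Real.fourier_eq]
  refine (norm_integral_le_integral_norm _).trans_eq ?_
  have e := Measure.integral_comp_mul_left (fun u : ℝ => |u| ^ k * |g u|) (2 * Real.pi)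
  rw [abs_of_pos (by positivity), smul_eq_mul] at e
  rw [← e]
  congr 1 with ξ
  simp [Circle.norm_smul, abs_mul, abs_of_pos Real.pi_pos]

theorem contDiff_scaledBspline {k d : ℕ} (hd : k + 2 < d) :
    ContDiff ℝ (k : ℕ∞) (scaledBspline d) :=
  contDiff_of_ofReal_eq_fourier (g := fun u => Real.sinc (Real.sqrt (3 / d) * u) ^ d)
    (scaledBspline_eq_fourier (by omega)
      (by simpa using integrable_pow_mul_sinc_pow (n := 0) (d := d) (by omega)))
    fun n hn => integrable_pow_mul_sinc_pow (by omega)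

/-! ### Uniform estimate -/

theorem exists_abs_rescaledBsplineDeriv_sub_gaussianDeriv_le (k : ℕ) :
    ∃ C, 0 ≤ C ∧ ∀ d : ℕ, k + 2 < d → ∀ x : ℝ,
      |rescaledBsplineDeriv k d x - gaussianDeriv k x| ≤ C / d := by
  obtain ⟨C, hC0, hC⟩ := exists_abs_pow_mul_sinc_pow_sub_exp_le k
  refine ⟨(2 * Real.pi)⁻¹ * (C * ∫ u : ℝ, (1 + u ^ 2)⁻¹), ?_, fun d hd x => ?_⟩
  · have : 0 ≤ ∫ u : ℝ, (1 + u ^ 2)⁻¹ := integral_nonneg fun u => by positivity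
    positivity
  have hB := contDiff_scaledBspline hd
  have hi : Integrable fun u : ℝ => Real.sinc (Real.sqrt (3 / d) * u) ^ d := by
    simpa using integrable_pow_mul_sinc_pow (n := 0) (d := d) (by omega)
  rw [rescaledBsplineDeriv_eq_iteratedDeriv (contDiff_bspline (by omega) hB),
    gaussianDeriv_eq_iteratedDeriv,
    ← iteratedDeriv_sub (mod_cast hB.contDiffAt) contDiff_gaussianDensity.contDiffAt]
  have hf : (fun x => ((scaledBspline d - gaussianDensity) x : ℂ)) =
      𝓕 fun ξ : ℝ => (((fun u : ℝ => Real.sinc (Real.sqrt (3 / d) * u) ^ d -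
        Real.exp (-u ^ 2 / 2)) (2 * Real.pi * ξ) : ℝ) : ℂ) := by
    have h₁ := integrable_pow_smul_ofReal_comp
      (integrable_pow_mul_sinc_pow (n := 0) (d := d) (by omega))
    have h₂ := integrable_pow_smul_ofReal_comp (integrable_pow_mul_exp_neg_sq_div_two 0)
    simp only [pow_zero, one_smul] at h₁ h₂
    ext x
    have e₁ := congrFun (scaledBspline_eq_fourier (by omega) hi) x
    have e₂ := congrFun gaussianDensity_eq_fourier x
    simp only [Pi.sub_apply, Complex.ofReal_sub]
    rw [e₁, e₂, Real.fourier_eq, Real.fourier_eq, Real.fourier_eq, ← integral_sub]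
    · simp only [smul_sub]
    · exact (Real.fourierIntegral_convergent_iff x).2 h₁
    · exact (Real.fourierIntegral_convergent_iff x).2 h₂
  refine (abs_iteratedDeriv_le_of_ofReal_eq_fourier hf
    (fun n hn => integrable_pow_mul_sinc_pow_sub_exp (by omega)) x).trans ?_
  have e : (2 * Real.pi)⁻¹ * (C * ∫ u : ℝ, (1 + u ^ 2)⁻¹) / d =
      (2 * Real.pi)⁻¹ * ∫ u : ℝ, C / d * (1 + u ^ 2)⁻¹ := by
    rw [integral_const_mul]; ring
  rw [e]
  gcongr ?_ * ?_
  refine integral_mono_of_nonneg (.of_forall fun u => by positivity)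
    (integrable_inv_one_add_sq.const_mul _) (.of_forall fun u => hC d hd u)

/-! ### Decay in `x` and `L^p` convergence -/

theorem exists_abs_polynomial_le (p : Polynomial ℝ) :
    ∃ (C : ℝ) (m : ℕ), 0 ≤ C ∧ ∀ x : ℝ, |p.eval x| ≤ C * (1 + x ^ 2) ^ m := by
  induction p using Polynomial.induction_on' with
  | add p q hp hq =>
    obtain ⟨C, m, hC, h⟩ := hp
    obtain ⟨C', m', hC', h'⟩ := hq
    refine ⟨C + C', max m m', by positivity, fun x => ?_⟩
    have h1 : 1 ≤ 1 + x ^ 2 := by linarith [sq_nonneg x]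
    rw [Polynomial.eval_add, add_mul]
    refine (abs_add_le _ _).trans (add_le_add ((h x).trans ?_) ((h' x).trans ?_))
    · gcongr
      exact le_max_left ..
    · gcongr
      exact le_max_right ..
  | monomial n a =>
    refine ⟨|a|, n, abs_nonneg a, fun x => ?_⟩
    rw [Polynomial.eval_monomial, abs_mul, abs_pow]
    gcongr
    exact abs_le_one_add_sq x

/-- The derivative is, up to sign and scale, a Hermite polynomial times the Gaussian, which beats
any polynomial. -/
theorem exists_abs_gaussianDeriv_le (k : ℕ) :
    ∃ C, 0 ≤ C ∧ ∀ x : ℝ, |gaussianDeriv k x| ≤ C * (1 + x ^ 2)⁻¹ := by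
  obtain ⟨C, m, hC0, hC⟩ := exists_abs_polynomial_le
    ((Polynomial.hermite k).map (Int.castRingHom ℝ))
  obtain ⟨C', hC'0, hC'⟩ := exists_one_add_sq_pow_mul_exp_le (m + 1) (c := 1 / 2) (by norm_num)
  refine ⟨1 / Real.sqrt (2 * Real.pi) * (C * C'), by positivity, fun x => ?_⟩
  have e : (fun t : ℝ => Real.exp (-t ^ 2 / 2)) = fun t => Real.exp (-(t ^ 2 / 2)) := by
    simp only [neg_div]
  rw [gaussianDeriv, e, iteratedDeriv_eq_iterate, Polynomial.deriv_gaussian_eq_hermite_mul_gaussian,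
    Polynomial.aeval_def, Polynomial.eval₂_eq_eval_map, abs_mul, abs_of_pos (by positivity), mul_assoc]
  rw [mul_assoc (1 / _)]
  gcongr ?_ * ?_
  rw [← div_eq_mul_inv, le_div_iff₀ (by positivity), abs_mul, abs_mul, abs_pow, abs_neg, abs_one,
    one_pow, one_mul, abs_of_pos (Real.exp_pos _)]
  calc _ ≤ C * (1 + x ^ 2) ^ m * Real.exp (-(x ^ 2 / 2)) * (1 + x ^ 2) := by
        gcongr
        exact hC x
    _ = C * ((1 + x ^ 2) ^ (m + 1) * Real.exp (-(1 / 2 * x ^ 2))) := by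
        rw [one_div_mul_eq_div]; ring
    _ ≤ C * C' := by gcongr; exact hC' x

theorem memLp_inv_sqrt_one_add_sq {p : ℝ≥0∞} (hp : 2 ≤ p) (hp' : p ≠ ∞) :
    MemLp (fun x : ℝ => (Real.sqrt (1 + x ^ 2))⁻¹) p := by
  have hc : Continuous fun x : ℝ => (Real.sqrt (1 + x ^ 2))⁻¹ :=
    Continuous.inv₀ (by fun_prop) fun x => Real.sqrt_ne_zero'.2 (by positivity)
  have hp0 : p ≠ 0 := (two_pos.trans_le hp).ne'
  have hpr : 2 ≤ p.toReal := by simpa using ENNReal.toReal_mono hp' hp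
  rw [← integrable_norm_rpow_iff hc.aestronglyMeasurable hp0 hp']
  have h := integrable_rpow_neg_one_add_norm_sq (E := ℝ) (μ := volume) (r := p.toReal)
    (by simp; linarith)
  refine h.congr (.of_forall fun x => ?_)
  dsimp only
  have hx : 0 ≤ (Real.sqrt (1 + x ^ 2))⁻¹ := by positivity
  rw [Real.norm_of_nonneg hx, Real.norm_eq_abs, sq_abs, Real.sqrt_eq_rpow,
    ← Real.rpow_neg (by positivity), ← Real.rpow_mul (by positivity)]
  congr 1; ring

/-- Here `√(d/12)|x| > d/2` when `d > 0`, so the argument leaves the support interval `[0, d]`. -/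
theorem rescaledBsplineDeriv_eq_zero {k d : ℕ} {x : ℝ} (hx : 3 * (d : ℝ) < x ^ 2) :
    rescaledBsplineDeriv k d x = 0 := by
  have ht : tsupport (bspline d) ⊆ Set.Icc 0 (d : ℝ) :=
    closure_minimal (support_bspline_subset d) isClosed_Icc
  have hs : Real.sqrt (d / 12) ^ 2 = d / 12 := Real.sq_sqrt (by positivity)
  rw [rescaledBsplineDeriv, iteratedDeriv_eq_iteratedFDeriv]
  have : iteratedFDeriv ℝ k (bspline d) (Real.sqrt (d / 12) * x + d / 2) = 0 := by
    by_contra h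
    have hm := ht (support_iteratedFDeriv_subset k (Function.mem_support.2 h))
    rw [Set.mem_Icc] at hm
    rcases (Nat.cast_nonneg (α := ℝ) d).eq_or_lt with h0 | h0
    · refine h ?_
      have : d = 0 := by exact_mod_cast h0.symm
      subst this
      simp [bspline]
    · have : (Real.sqrt (d / 12) * x) ^ 2 ≤ (d / 2 : ℝ) ^ 2 :=
        sq_le_sq' (by linarith) (by linarith)
      rw [mul_pow, hs] at this
      nlinarith
  rw [this]
  simp

theorem continuous_rescaledBsplineDeriv {k d : ℕ} (h : ContDiff ℝ (k : ℕ∞) (bspline d)) :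
    Continuous (rescaledBsplineDeriv k d) :=
  continuous_const.mul ((h.continuous_iteratedDeriv k le_rfl).comp (by fun_prop))

theorem memLp_rescaledBsplineDeriv {k d : ℕ} (h : ContDiff ℝ (k : ℕ∞) (bspline d)) (p : ℝ≥0∞) :
    MemLp (rescaledBsplineDeriv k d) p := by
  refine (continuous_rescaledBsplineDeriv h).memLp_of_hasCompactSupport ?_
  refine HasCompactSupport.intro (isCompact_Icc (a := -Real.sqrt (3 * d)) (b := Real.sqrt (3 * d)))
    fun x hx => rescaledBsplineDeriv_eq_zero ?_
  contrapose! hx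
  exact abs_le.1 (Real.abs_le_sqrt hx)

theorem continuous_gaussianDeriv (k : ℕ) : Continuous (gaussianDeriv k) := by
  rw [gaussianDeriv_eq_iteratedDeriv]
  exact (contDiff_gaussianDensity (n := k)).continuous_iteratedDeriv k le_rfl

theorem inv_one_add_sq_le_inv_sqrt (x : ℝ) : (1 + x ^ 2)⁻¹ ≤ (Real.sqrt (1 + x ^ 2))⁻¹ := by
  have h1 : 1 ≤ 1 + x ^ 2 := by linarith [sq_nonneg x]
  gcongr
  exact (Real.sqrt_le_left (by positivity)).2 (by nlinarith)

theorem memLp_gaussianDeriv (k : ℕ) {p : ℝ≥0∞} (hp : 2 ≤ p) (hp' : p ≠ ∞) :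
    MemLp (gaussianDeriv k) p := by
  obtain ⟨C, hC0, hC⟩ := exists_abs_gaussianDeriv_le k
  refine (memLp_inv_sqrt_one_add_sq hp hp').of_le_mul (c := C)
    (continuous_gaussianDeriv k).aestronglyMeasurable (.of_forall fun x => ?_)
  rw [Real.norm_eq_abs, Real.norm_of_nonneg (by positivity)]
  refine (hC x).trans ?_
  exact mul_le_mul_of_nonneg_left (inv_one_add_sq_le_inv_sqrt x) hC0

theorem exists_abs_rescaledBsplineDeriv_sub_gaussianDeriv_le_mul (k : ℕ) :
    ∃ C, 0 ≤ C ∧ ∀ d : ℕ, k + 2 < d → ∀ x : ℝ,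
      |rescaledBsplineDeriv k d x - gaussianDeriv k x| ≤
        C / Real.sqrt d * (Real.sqrt (1 + x ^ 2))⁻¹ := by
  obtain ⟨A, hA0, hA⟩ := exists_abs_rescaledBsplineDeriv_sub_gaussianDeriv_le k
  obtain ⟨B, hB0, hB⟩ := exists_abs_gaussianDeriv_le k
  refine ⟨2 * A + B, by positivity, fun d hd x => ?_⟩
  have hd0 : (1 : ℝ) ≤ d := by exact_mod_cast (by omega : 1 ≤ d)
  have hd1 : 0 < Real.sqrt d := by positivity
  have hx1 : 0 < Real.sqrt (1 + x ^ 2) := by positivity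
  rw [← div_eq_mul_inv]
  rcases lt_or_ge (3 * (d : ℝ)) (x ^ 2) with h | h
  · rw [rescaledBsplineDeriv_eq_zero h, zero_sub, abs_neg]
    calc _ ≤ B * (1 + x ^ 2)⁻¹ := hB x
      _ = B / Real.sqrt (1 + x ^ 2) / Real.sqrt (1 + x ^ 2) := by
        rw [div_div, Real.mul_self_sqrt (by positivity), div_eq_mul_inv]
      _ ≤ (2 * A + B) / Real.sqrt d / Real.sqrt (1 + x ^ 2) := by
        gcongr <;> linarith
  · calc _ ≤ A / d := hA d hd x
      _ = A / Real.sqrt d / Real.sqrt d := by rw [div_div, Real.mul_self_sqrt (by positivity)]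
      -- From `x² ≤ 3d` and `d ≥ 1`, `1 + x² ≤ 4d`.
      _ ≤ A / Real.sqrt d / (Real.sqrt (1 + x ^ 2) / 2) := by
        gcongr
        rw [div_le_iff₀ two_pos]
        refine Real.sqrt_le_iff.2 ⟨by positivity, ?_⟩
        rw [mul_pow, Real.sq_sqrt (by positivity)]
        linarith
      _ = 2 * A / Real.sqrt d / Real.sqrt (1 + x ^ 2) := by field_simp
      _ ≤ _ := by gcongr; linarith

theorem tendsto_eLpNorm_rescaledBsplineDeriv_sub (k : ℕ) {p : ℝ≥0∞} (hp : 2 ≤ p) (hp' : p ≠ ∞) :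
    Tendsto (fun d : ℕ => eLpNorm (fun x => rescaledBsplineDeriv k d x - gaussianDeriv k x) p volume)
      atTop (𝓝 0) := by
  obtain ⟨C, hC0, hC⟩ := exists_abs_rescaledBsplineDeriv_sub_gaussianDeriv_le_mul k
  have hg := memLp_inv_sqrt_one_add_sq hp hp'
  have ht : Tendsto (fun d : ℕ => ENNReal.ofReal (C / Real.sqrt d) *
      eLpNorm (fun x : ℝ => (Real.sqrt (1 + x ^ 2))⁻¹) p volume) atTop (𝓝 0) := by
    have h₁ : Tendsto (fun d : ℕ => C / Real.sqrt d) atTop (𝓝 0) :=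
      tendsto_const_nhds.div_atTop (Real.tendsto_sqrt_atTop.comp tendsto_natCast_atTop_atTop)
    have h₂ := ENNReal.Tendsto.mul_const (ENNReal.tendsto_ofReal h₁)
      (.inr hg.eLpNorm_ne_top)
    simpa using h₂
  refine tendsto_of_tendsto_of_tendsto_of_le_of_le' tendsto_const_nhds ht
    (.of_forall fun _ => zero_le) ?_
  filter_upwards [eventually_gt_atTop (k + 2)] with d hd
  refine eLpNorm_le_mul_eLpNorm_of_ae_le_mul (.of_forall fun x => ?_) p
  rw [Real.norm_eq_abs, Real.norm_of_nonneg (by positivity)]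
  exact hC d hd x

theorem theorem3p1 (k : ℕ) :
    (∀ d : ℕ, k + 2 < d → ContDiff ℝ (k : ℕ∞) (bspline d)) ∧
    (∃ C : ℝ, ∀ d : ℕ, k + 2 < d → ∀ x : ℝ,
      |rescaledBsplineDeriv k d x - gaussianDeriv k x| ≤ C / (d : ℝ)) ∧
    (∀ x : ℝ, Tendsto (fun d : ℕ => rescaledBsplineDeriv k d x) atTop (𝓝 (gaussianDeriv k x))) ∧
    (∀ p : ℝ≥0∞, 2 ≤ p → p ≠ ∞ →
      MemLp (gaussianDeriv k) p volume ∧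
      (∀ d : ℕ, k + 2 < d → MemLp (rescaledBsplineDeriv k d) p volume) ∧
      Tendsto (fun d : ℕ => eLpNorm (fun x => rescaledBsplineDeriv k d x - gaussianDeriv k x) p volume)
        atTop (𝓝 0)) := by
  have hB : ∀ d : ℕ, k + 2 < d → ContDiff ℝ (k : ℕ∞) (bspline d) := fun d hd =>
    contDiff_bspline (by omega) (contDiff_scaledBspline hd)
  obtain ⟨C, -, hC⟩ := exists_abs_rescaledBsplineDeriv_sub_gaussianDeriv_le k
  refine ⟨hB, ⟨C, hC⟩, fun x => ?_, fun p hp hp' => ⟨memLp_gaussianDeriv k hp hp',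
    fun d hd => memLp_rescaledBsplineDeriv (hB d hd) p,
    tendsto_eLpNorm_rescaledBsplineDeriv_sub k hp hp'⟩⟩
  rw [tendsto_iff_dist_tendsto_zero]
  refine squeeze_zero' (.of_forall fun _ => dist_nonneg) ?_
    (tendsto_const_div_atTop_nhds_zero_nat C)
  filter_upwards [eventually_gt_atTop (k + 2)] with d hd
  exact hC d hd x
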